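/- \textbf{Conventions.} Values lie in $[0,\infty]$, $\inf\emptyset=\infty$, $\sup\emptyset=0$, $\infty-\infty=0$ and $t_+=\max(t,0)$. A \emph{distance} on a set $X$ is a function $\mathbf d:X\times X\to[0,\infty]$, $(x,y)\mapsto x\mathbf dy$, with $x\mathbf dz\le x\mathbf dy+y\mathbf dz$ for all $x,y,z$. Its upper and lower hemimetrics are \[x\overline{\mathbf d}z=\sup_{y\in X}(x\mathbf dy-z\mathbf dy)_+,\qquad z\underline{\mathbf d}y=\sup_{x\in X}(x\mathbf dy-x\mathbf dz)_+ .\] A set $Y\subseteq X$ is \emph{$\mathbf d$-directed} if $\inf_{y\in Y}\sup_{z\in F}z\mathbf dy=0$ for every finite $F\subseteq Y$. Nets are indexed by nonempty sets with a transitive (not necessarily reflexive) relation $\prec$ such that any two elements $\gamma,\delta$ have some $\lambda$ with $\gamma\prec\lambda$ and $\delta\prec\lambda$. Limits are taken along the tails $\{\delta:\gamma\prec\delta\}$. A net $(x_\lambda)$ is \emph{$\mathbf d$-Cauchy} if $\lim_\gamma\sup_{\gamma\prec\delta}x_\gamma\mathbf dx_\delta=0$. The \emph{Smyth topology} $\mathbf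 d^\bullet_\circ$ is generated by the sets $\{x:c\mathbf dx<r\}$ and $\{x:c\mathbf dx>r\}$. A subset $B\subseteq X$ is a \emph{$\mathbf d^\bullet_\circ$-basis} if every $x\in X$ is a $\mathbf d^\bullet_\circ$-limit of a $\mathbf d$-Cauchy net in $B$; $X$ is \emph{$\mathbf d^\bullet_\circ$-continuous} if $X$ itself is a $\mathbf d^\bullet_\circ$-basis, and \emph{$\mathbf d^\bullet_\circ$-complete} if every $\mathbf d$-Cauchy net has a $\mathbf d^\bullet_\circ$-limit. $X$ is a \emph{$\mathbf d^\bullet_\circ$-domain} if it is $\mathbf d^\bullet_\circ$-continuous, $\mathbf d^\bullet_\circ$-complete and $\overline{\mathbf d}\le\underline{\mathbf d}$. On the set of formal balls $X_+=X\times[0,\infty)$ let $(x,r)\mathbf d_+(y,s)=(x\mathbf dy-r+s)_+$. For $Y,Z\subseteq X_+$ let \[Y\mathbf d_+^{\mathcal H}Z=\inf_{z\in Z}\sup_{y\in Y}y\mathbf d_+z,\qquad Y\mathbf d_{+\mathcal H}Z=\sup_{y\in Y}\inf_{z\in Z}y\mathbf d_+z .\] Let $\mathcal P_0^{\mathbf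 d}(X)$ be the set of $\mathbf d_+$-directed $Y\subseteq X_+$ with $\inf_{(x,r)\in Y}r=0$, and for $x\in X$ let $x_0=\{(y,s)\in X_+:y\mathbf dx\le s\}$. \textbf{Theorem.} Let $\mathbf d$ be a distance on a set $X$ such that $X$ is $\mathbf d^\bullet_\circ$-continuous. Then \[\underline{\mathbf d_+^{\mathcal H}|_{\mathcal P_0^{\mathbf d}(X)}}=\mathbf d_{+\mathcal H}|_{\mathcal P_0^{\mathbf d}(X)} .\] Moreover, $\mathbf d_+^{\mathcal H}$ restricts to a distance on $\mathcal P_0^{\mathbf d}(X)$, with respect to which $\mathcal P_0^{\mathbf d}(X)$ is a ${\mathbf d_+^{\mathcal H}}{}^\bullet_\circ$-domain. Every $x_0$ $(x\in X)$ belongs to $\mathcal P_0^{\mathbf d}(X)$, the set $\{x_0:x\in X\}$ is a ${\mathbf d_+^{\mathcal H}}{}^\bullet_\circ$-basis of $\mathcal P_0^{\mathbf d}(X)$, and $x_0\,\mathbf d_+^{\mathcal H}\,y_0\le x\mathbf dy$ for all $x,y\in X$. -/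

import Mathlib

open Set Filter Topology
open scoped NNReal ENNReal

universe u v w

namespace DistanceDomain

/-- The triangle inequality: a distance is a function `X × X → [0,∞]` satisfying it
(no symmetry and no `d x x = 0`). -/
def IsDistance {X : Type u} (d : X → X → ℝ≥0∞) : Prop :=
  ∀ x y z, d x z ≤ d x y + d y z

/-- The upper hemimetric `x, z ↦ sup_y (d x y - d z y)₊` (with `∞ - ∞ = 0`). -/
noncomputable def upperHemi {X : Type u} (d : X → X → ℝ≥0∞) (x z : X) : ℝ≥0∞ :=
  ⨆ y, (d x y - d z y)

/-- The lower hemimetric `z, y ↦ sup_x (d x y - d x z)₊` (with `∞ - ∞ = 0`). -/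
noncomputable def lowerHemi {X : Type u} (d : X → X → ℝ≥0∞) (z y : X) : ℝ≥0∞ :=
  ⨆ x, (d x y - d x z)

/-- `Y` is `d`-directed: `inf_{y ∈ Y} sup_{z ∈ F} d z y = 0` for all finite `F ⊆ Y`
(so `Y` is nonempty, by `F = ∅` and `inf ∅ = ∞`). -/
def IsDirectedSet {X : Type u} (d : X → X → ℝ≥0∞) (Y : Set X) : Prop :=
  ∀ F : Set X, F.Finite → F ⊆ Y → ⨅ y ∈ Y, ⨆ z ∈ F, d z y = 0

/-- An index set of nets: a nonempty set with a transitive, not necessarily reflexive,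
directed relation. -/
structure IsNetOrder {L : Type w} (r : L → L → Prop) : Prop where
  nonempty : Nonempty L
  trans : ∀ a b c, r a b → r b c → r a c
  directed : ∀ a b, ∃ c, r a c ∧ r b c

/-- The filter generated by the tails `{δ | γ ≺ δ}`; limits of nets are limits along it. -/
def tails {L : Type w} (r : L → L → Prop) : Filter L :=
  ⨅ γ, 𝓟 {δ | r γ δ}

/-- The net `x` is `d`-Cauchy: `lim_γ sup_{γ ≺ δ} d (x γ) (x δ) = 0`. -/
def IsCauchyNet {X : Type u} (d : X → X → ℝ≥0∞) {L : Type w} (r : L → L → Prop)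
    (x : L → X) : Prop :=
  Tendsto (fun γ => ⨆ δ, ⨆ _ : r γ δ, d (x γ) (x δ)) (tails r) (𝓝 0)

/-- The net `x` converges to `a` in the topology `T`. -/
def NetConverges {X : Type u} (T : TopologicalSpace X) {L : Type w} (r : L → L → Prop)
    (x : L → X) (a : X) : Prop :=
  Tendsto x (tails r) (@nhds X T a)

/-- The Smyth topology, generated by the upper balls `{x | d c x < r}` and the lower holes
`{x | d c x > r}`. -/
@[reducible]
def smythTopology {X : Type u} (d : X → X → ℝ≥0∞) : TopologicalSpace X :=
  TopologicalSpace.generateFrom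
    ({U | ∃ c r, U = {x | d c x < r}} ∪ {U | ∃ c r, U = {x | r < d c x}})

/-- `B` is a `d`-`T`-basis: every point is a `T`-limit of a `d`-Cauchy net in `B`
(with index set in `Type w`). -/
def IsNetBasis {X : Type u} (d : X → X → ℝ≥0∞) (T : TopologicalSpace X) (B : Set X) : Prop :=
  ∀ a : X, ∃ (L : Type w) (r : L → L → Prop) (x : L → X),
    IsNetOrder r ∧ IsCauchyNet d r x ∧ (∀ γ, x γ ∈ B) ∧ NetConverges T r x a

/-- `X` is `d`-`T`-continuous: every point is a `T`-limit of a `d`-Cauchy net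
(with index set in `Type w`). -/
def IsNetContinuous {X : Type u} (d : X → X → ℝ≥0∞) (T : TopologicalSpace X) : Prop :=
  ∀ a : X, ∃ (L : Type w) (r : L → L → Prop) (x : L → X),
    IsNetOrder r ∧ IsCauchyNet d r x ∧ NetConverges T r x a

/-- `X` is `d`-`T`-complete: every `d`-Cauchy net (with index set in `Type w`) has a
`T`-limit. -/
def IsNetComplete {X : Type u} (d : X → X → ℝ≥0∞) (T : TopologicalSpace X) : Prop :=
  ∀ (L : Type w) (r : L → L → Prop) (x : L → X),
    IsNetOrder r → IsCauchyNet d r x → ∃ a : X, NetConverges T r x a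

/-- `X` is a `d`-`T`-predomain: it is continuous and the upper hemimetric is at most the
lower one. -/
def IsNetPredomain {X : Type u} (d : X → X → ℝ≥0∞) (T : TopologicalSpace X) : Prop :=
  IsNetContinuous.{u, w} d T ∧ ∀ x y, upperHemi d x y ≤ lowerHemi d x y

/-- `X` is a `d`-`T`-domain: a complete predomain (and `d` is a distance). -/
def IsNetDomain {X : Type u} (d : X → X → ℝ≥0∞) (T : TopologicalSpace X) : Prop :=
  IsDistance d ∧ IsNetPredomain.{u, w} d T ∧ IsNetComplete.{u, w} d T

/-- The reverse Hausdorff distance `inf_{z ∈ Z} sup_{y ∈ Y} d y z`. -/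
noncomputable def revHausdorff {X : Type u} (d : X → X → ℝ≥0∞) (Y Z : Set X) : ℝ≥0∞ :=
  ⨅ z ∈ Z, ⨆ y ∈ Y, d y z

/-- The (one-sided) Hausdorff distance `sup_{y ∈ Y} inf_{z ∈ Z} d y z`. -/
noncomputable def hausdorff {X : Type u} (d : X → X → ℝ≥0∞) (Y Z : Set X) : ℝ≥0∞ :=
  ⨆ y ∈ Y, ⨅ z ∈ Z, d y z

/-- The distance `(x,r), (y,s) ↦ (d x y - r + s)₊` on the formal balls `X × [0,∞)`. -/
noncomputable def ballDist {X : Type u} (d : X → X → ℝ≥0∞) (p q : X × ℝ≥0) : ℝ≥0∞ :=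
  (d p.1 q.1 + (q.2 : ℝ≥0∞)) - (p.2 : ℝ≥0∞)

/-- The aperture of a set of formal balls. -/
noncomputable def aperture {X : Type u} (Y : Set (X × ℝ≥0)) : ℝ≥0∞ :=
  ⨅ p ∈ Y, (p.2 : ℝ≥0∞)

/-- The directed sets of formal balls with zero aperture. -/
def ZeroDirected {X : Type u} (d : X → X → ℝ≥0∞) : Set (Set (X × ℝ≥0)) :=
  {Y | IsDirectedSet (ballDist d) Y ∧ aperture Y = 0}

/-- The set of formal balls `p` with `p ≤ (x,0)`, that is, with `ballDist d p (x,0) = 0`. -/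
def lowerBalls {X : Type u} (d : X → X → ℝ≥0∞) (x : X) : Set (X × ℝ≥0) :=
  {p | ballDist d p (x, 0) = 0}

/-- The reverse Hausdorff distance of formal balls, restricted to `ZeroDirected d`. -/
noncomputable def revHausdorffZero {X : Type u} (d : X → X → ℝ≥0∞)
    (Y Z : ZeroDirected d) : ℝ≥0∞ :=
  revHausdorff (ballDist d) (Y : Set (X × ℝ≥0)) (Z : Set (X × ℝ≥0))

/-- The Hausdorff distance of formal balls, restricted to `ZeroDirected d`. -/
noncomputable def hausdorffZero {X : Type u} (d : X → X → ℝ≥0∞)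
    (Y Z : ZeroDirected d) : ℝ≥0∞ :=
  hausdorff (ballDist d) (Y : Set (X × ℝ≥0)) (Z : Set (X × ℝ≥0))

end DistanceDomain

open DistanceDomain

namespace DistanceDomain

variable {X : Type u}

/-! ### Nets and Smyth convergence. -/

section Nets

variable {L : Type w} {r : L → L → Prop}

/-! Write `D` for the reverse Hausdorff distance and `H` for the Hausdorff distance. The triangle
inequality still holds when either term on its right is weakened from `D` to `H`
(`revHausdorff_le_add_hausdorff`, `revHausdorff_le_hausdorff_add`), so both hemimetrics of `D` are
at most `H`. Conversely, for a ball `(x,r)` far up in `Y`, the set `x₀` satisfies `D(x₀,Y) ≤ r`,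
while any given ball of `Y` lies in `x₀` after a slight enlargement; testing the lower hemimetric on
`x₀` recovers `H` (`hausdorffZero_le_lowerHemi`).

A Cauchy net of sets converges to the set of balls whose distance to its members tends to `0`
(`limitBalls`). Each `Y` is the limit of the sets `x₀` over its own centres `x`, with `Y` as the
index set up to tolerances (`isNetBasis_range_lowerBalls`). Continuity of `X` enters only through
`exists_approx`. -/

theorem eventually_tails (hr : IsNetOrder r) {p : L → Prop} :
    (∀ᶠ δ in tails r, p δ) ↔ ∃ γ, ∀ δ, r γ δ → p δ := by
  have := hr.nonempty
  unfold tails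
  rw [Filter.eventually_iff, mem_iInf_of_directed]
  · simp [Set.subset_def]
  · intro a b
    obtain ⟨c, hac, hbc⟩ := hr.directed a b
    exact ⟨c, principal_mono.2 fun x hx => hr.trans _ _ _ hac hx,
      principal_mono.2 fun x hx => hr.trans _ _ _ hbc hx⟩

theorem tails_neBot (hr : IsNetOrder r) : (tails r).NeBot := by
  rw [← Filter.frequently_true_iff_neBot, Filter.Frequently, eventually_tails hr]
  rintro ⟨γ, h⟩
  obtain ⟨δ, hδ, -⟩ := hr.directed γ γ
  exact h δ hδ trivial

theorem IsCauchyNet.eventually {d : X → X → ℝ≥0∞} {x : L → X} (h : IsCauchyNet d r x)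
    {ε : ℝ≥0} (hε : 0 < ε) : ∀ᶠ γ in tails r, ∀ δ, r γ δ → d (x γ) (x δ) ≤ ε := by
  filter_upwards [ENNReal.tendsto_nhds_zero.1 h ε (by exact_mod_cast hε)] with γ hγ
  simpa using hγ

theorem isCauchyNet_iff {d : X → X → ℝ≥0∞} {x : L → X} :
    IsCauchyNet d r x ↔
      ∀ ε : ℝ≥0, 0 < ε → ∀ᶠ γ in tails r, ∀ δ, r γ δ → d (x γ) (x δ) ≤ ε := by
  refine ⟨fun h ε hε => h.eventually hε, fun h => ENNReal.tendsto_nhds_zero.2 fun ε hε => ?_⟩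
  obtain ⟨η, hη, hηε⟩ := ENNReal.lt_iff_exists_nnreal_btwn.1 hε
  filter_upwards [h η (by exact_mod_cast hη)] with γ hγ
  exact iSup₂_le fun δ hδ => (hγ δ hδ).trans hηε.le

theorem netConverges_smyth_of_forall {d : X → X → ℝ≥0∞} {x : L → X} {a : X}
    (hle : ∀ c, ∀ ε : ℝ≥0, 0 < ε → d c a ≠ ∞ → ∀ᶠ γ in tails r, d c (x γ) ≤ d c a + ε)
    (hge : ∀ c, ∀ ε : ℝ≥0, 0 < ε → ∀ᶠ γ in tails r, d c a ≤ d c (x γ) + ε) :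
    NetConverges (smythTopology d) r x a := by
  refine TopologicalSpace.tendsto_nhds_generateFrom_iff.2 ?_
  rintro s (⟨c, t, rfl⟩ | ⟨c, t, rfl⟩) ha
  · obtain ⟨ε, hε, h⟩ := ENNReal.lt_iff_exists_add_pos_lt.1 (show d c a < t from ha)
    filter_upwards [hle c ε hε (ne_top_of_lt (show d c a < t from ha))] with γ hγ
    exact hγ.trans_lt h
  · obtain ⟨ε, hε, h⟩ := ENNReal.lt_iff_exists_add_pos_lt.1 (show t < d c a from ha)
    filter_upwards [hge c ε hε] with γ hγ
    exact lt_of_add_lt_add_right (h.trans_le hγ)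

theorem NetConverges.eventually_lt {d : X → X → ℝ≥0∞} {x : L → X} {a : X}
    (h : NetConverges (smythTopology d) r x a) {c : X} {t : ℝ≥0∞} (ht : d c a < t) :
    ∀ᶠ γ in tails r, d c (x γ) < t :=
  TopologicalSpace.tendsto_nhds_generateFrom_iff.1 h _ (Or.inl ⟨c, t, rfl⟩) ht

theorem NetConverges.eventually_gt {d : X → X → ℝ≥0∞} {x : L → X} {a : X}
    (h : NetConverges (smythTopology d) r x a) {c : X} {t : ℝ≥0∞} (ht : t < d c a) :
    ∀ᶠ γ in tails r, t < d c (x γ) :=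
  TopologicalSpace.tendsto_nhds_generateFrom_iff.1 h _ (Or.inr ⟨c, t, rfl⟩) ht

/-- A Cauchy net converging in the Smyth topology approximates its limit from below. -/
theorem IsCauchyNet.eventually_le_of_netConverges {d : X → X → ℝ≥0∞} {x : L → X} {a : X}
    (hr : IsNetOrder r) (hx : IsCauchyNet d r x) (ha : NetConverges (smythTopology d) r x a)
    {ε : ℝ≥0} (hε : 0 < ε) : ∀ᶠ γ in tails r, d (x γ) a ≤ ε := by
  have := tails_neBot hr
  filter_upwards [hx.eventually hε] with γ hγ
  -- Otherwise a lower hole centred at `x γ` contains `a`, hence some later `x δ`, against the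
  -- Cauchy bound.
  by_contra! h
  obtain ⟨δ, h₁, h₂⟩ := ((ha.eventually_gt h).and
    ((eventually_tails hr).2 ⟨γ, hγ⟩)).exists
  exact absurd h₁ h₂.not_gt

end Nets

/-- In a Smyth continuous space every point is approximated from below, compatibly with the
distances from finitely many given points. -/
theorem exists_approx {d : X → X → ℝ≥0∞} (hc : IsNetContinuous.{u, v} d (smythTopology d))
    (x : X) {F : Set X} (hF : F.Finite) (hFx : ∀ c ∈ F, d c x ≠ ∞) {ε : ℝ≥0} (hε : 0 < ε) :
    ∃ y, d y x ≤ ε ∧ ∀ c ∈ F, d c y ≤ d c x + ε := by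
  obtain ⟨L, r, n, hr, hn, hx⟩ := hc x
  have := tails_neBot hr
  have h : ∀ᶠ γ in tails r, ∀ c ∈ F, d c (n γ) ≤ d c x + ε :=
    (eventually_all_finite hF).2 fun c hcF =>
      (hx.eventually_lt (ENNReal.lt_add_right (hFx c hcF)
        (by exact_mod_cast hε.ne'))).mono fun _ => le_of_lt
  obtain ⟨γ, h₁, h₂⟩ := ((hn.eventually_le_of_netConverges hr hx hε).and h).exists
  exact ⟨n γ, h₁, h₂⟩

/-! ### Formal balls. -/

section Balls

variable {d : X → X → ℝ≥0∞} {p q : X × ℝ≥0} {Y Z W : Set (X × ℝ≥0)}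

theorem ballDist_le_iff {a : ℝ≥0∞} : ballDist d p q ≤ a ↔ d p.1 q.1 + q.2 ≤ a + p.2 :=
  tsub_le_iff_right

theorem dist_add_le_ballDist_add (p q : X × ℝ≥0) :
    d p.1 q.1 + q.2 ≤ ballDist d p q + p.2 :=
  ballDist_le_iff.1 le_rfl

theorem radius_le_ballDist_add (p q : X × ℝ≥0) :
    (q.2 : ℝ≥0∞) ≤ ballDist d p q + p.2 :=
  le_add_self.trans (dist_add_le_ballDist_add p q)

theorem isDistance_ballDist (hd : IsDistance d) : IsDistance (ballDist d) := by
  intro p q s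
  rw [ballDist_le_iff]
  calc d p.1 s.1 + s.2 ≤ d p.1 q.1 + (d q.1 s.1 + s.2) := by
        rw [← add_assoc]; gcongr; exact hd _ _ _
    _ ≤ d p.1 q.1 + (ballDist d q s + q.2) := add_le_add_right (dist_add_le_ballDist_add q s) _
    _ = ballDist d q s + (d p.1 q.1 + q.2) := by ring
    _ ≤ ballDist d q s + (ballDist d p q + p.2) := add_le_add_right (dist_add_le_ballDist_add p q) _
    _ = ballDist d p q + ballDist d q s + p.2 := by ring

theorem mem_lowerBalls {x : X} : p ∈ lowerBalls d x ↔ d p.1 x ≤ p.2 := by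
  simp only [lowerBalls, mem_ofPred_eq, ← nonpos_iff_eq_zero, ballDist_le_iff]
  simp

/-- The ball `p` with its radius enlarged by `ε`. -/
def enlarge (p : X × ℝ≥0) (ε : ℝ≥0) : X × ℝ≥0 := (p.1, p.2 + ε)

theorem ballDist_le_enlarge_add (p q : X × ℝ≥0) (ε : ℝ≥0) :
    ballDist d p q ≤ ballDist d (enlarge p ε) q + ε := by
  rw [ballDist_le_iff]
  have := dist_add_le_ballDist_add (d := d) (enlarge p ε) q
  simp only [enlarge, ENNReal.coe_add] at this ⊢
  exact this.trans_eq (by ring)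

theorem ballDist_enlarge_le (p q : X × ℝ≥0) (ε : ℝ≥0) :
    ballDist d p (enlarge q ε) ≤ ballDist d p q + ε := by
  rw [ballDist_le_iff]
  have := dist_add_le_ballDist_add (d := d) p q
  simp only [enlarge, ENNReal.coe_add]
  calc _ = (d p.1 q.1 + q.2) + ε := by ring
    _ ≤ (ballDist d p q + p.2) + ε := by gcongr
    _ = _ := by ring

theorem ballDist_enlarge_eq_zero {ε : ℝ≥0} (h : ballDist d p q ≤ ε) :
    ballDist d (enlarge p ε) q = 0 := by
  rw [← nonpos_iff_eq_zero, ballDist_le_iff]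
  rw [ballDist_le_iff] at h
  simpa [enlarge, add_comm] using h

/-! ### Hausdorff distances and their hemimetrics. -/

/-- The distance from a ball to a set of balls. -/
noncomputable def ballInf (d : X → X → ℝ≥0∞) (p : X × ℝ≥0) (Z : Set (X × ℝ≥0)) : ℝ≥0∞ :=
  ⨅ q ∈ Z, ballDist d p q

theorem ballInf_le (hq : q ∈ Z) : ballInf d p Z ≤ ballDist d p q := iInf₂_le q hq

theorem ballInf_le_hausdorff (hp : p ∈ Y) : ballInf d p Z ≤ hausdorff (ballDist d) Y Z :=
  le_iSup₂ (f := fun y (_ : y ∈ Y) => ⨅ z ∈ Z, ballDist d y z) p hp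

theorem hausdorff_le_iff {a : ℝ≥0∞} :
    hausdorff (ballDist d) Y Z ≤ a ↔ ∀ p ∈ Y, ballInf d p Z ≤ a := iSup₂_le_iff

theorem exists_ballDist_le {a : ℝ≥0∞} (ha : ballInf d p Z ≤ a) (ha' : a ≠ ∞) {ε : ℝ≥0}
    (hε : 0 < ε) : ∃ q ∈ Z, ballDist d p q ≤ a + ε := by
  have : ballInf d p Z < a + ε :=
    ha.trans_lt (ENNReal.lt_add_right ha' (by exact_mod_cast hε.ne'))
  simp only [ballInf, iInf_lt_iff] at this
  obtain ⟨q, hq, h⟩ := this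
  exact ⟨q, hq, h.le⟩

theorem revHausdorff_le {a : ℝ≥0∞} (hq : q ∈ Z) (h : ∀ p ∈ Y, ballDist d p q ≤ a) :
    revHausdorff (ballDist d) Y Z ≤ a :=
  (iInf₂_le q hq).trans (iSup₂_le h)

theorem exists_of_revHausdorff_le {a : ℝ≥0∞} (h : revHausdorff (ballDist d) Y Z ≤ a)
    (ha : a ≠ ∞) {ε : ℝ≥0} (hε : 0 < ε) : ∃ q ∈ Z, ∀ p ∈ Y, ballDist d p q ≤ a + ε := by
  have : revHausdorff (ballDist d) Y Z < a + ε :=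
    h.trans_lt (ENNReal.lt_add_right ha (by exact_mod_cast hε.ne'))
  simp only [revHausdorff, iInf_lt_iff] at this
  obtain ⟨q, hq, h⟩ := this
  exact ⟨q, hq, iSup₂_le_iff.1 h.le⟩

theorem hausdorff_le_revHausdorff :
    hausdorff (ballDist d) Y Z ≤ revHausdorff (ballDist d) Y Z :=
  iSup₂_le fun y hy => le_iInf₂ fun z hz => (iInf₂_le z hz).trans
    (le_iSup₂ (f := fun y (_ : y ∈ Y) => ballDist d y z) y hy)

theorem revHausdorff_le_add_ballInf (hd : IsDistance d) {a : ℝ≥0∞}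
    (h : ∀ p ∈ Y, ballDist d p q ≤ a) :
    revHausdorff (ballDist d) Y Z ≤ a + ballInf d q Z := by
  refine ENNReal.le_of_forall_pos_le_add fun ε hε hlt => ?_
  obtain ⟨z, hz, hqz⟩ :=
    exists_ballDist_le (le_refl (ballInf d q Z)) (ENNReal.add_lt_top.1 hlt).2.ne hε
  refine revHausdorff_le hz fun p hp => ?_
  rw [add_assoc]
  exact (isDistance_ballDist hd p q z).trans (add_le_add (h p hp) hqz)

/-- A single nearly optimal `y` serves all of `W`, and only this `y` has to be moved into `Z`. -/
theorem revHausdorff_le_add_hausdorff (hd : IsDistance d) :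
    revHausdorff (ballDist d) W Z ≤
      revHausdorff (ballDist d) W Y + hausdorff (ballDist d) Y Z := by
  refine ENNReal.le_of_forall_pos_le_add fun ε hε hlt => ?_
  obtain ⟨y, hy, h⟩ := exists_of_revHausdorff_le (le_refl (revHausdorff (ballDist d) W Y))
    (ENNReal.add_lt_top.1 hlt).1.ne hε
  calc _ ≤ _ + ballInf d y Z := revHausdorff_le_add_ballInf hd h
    _ ≤ _ + hausdorff (ballDist d) Y Z := add_le_add_right (ballInf_le_hausdorff hy) _
    _ = _ := by ring

/-- Each ball of `Y` may choose its own `z`, because one nearly optimal `w` serves all of `Z`. -/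
theorem revHausdorff_le_hausdorff_add (hd : IsDistance d) :
    revHausdorff (ballDist d) Y W ≤
      hausdorff (ballDist d) Y Z + revHausdorff (ballDist d) Z W := by
  refine ENNReal.le_of_forall_pos_le_add fun ε hε hlt => ?_
  obtain ⟨hH, hD⟩ := ENNReal.add_lt_top.1 hlt
  obtain ⟨w, hw, h⟩ := exists_of_revHausdorff_le (le_refl (revHausdorff (ballDist d) Z W))
    hD.ne (half_pos hε)
  refine revHausdorff_le hw fun p hp => ?_
  obtain ⟨z, hz, hpz⟩ := exists_ballDist_le (ballInf_le_hausdorff (Z := Z) hp) hH.ne (half_pos hε)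
  calc _ ≤ ballDist d p z + ballDist d z w := isDistance_ballDist hd p z w
    _ ≤ _ := add_le_add hpz (h z hz)
    _ = hausdorff (ballDist d) Y Z + revHausdorff (ballDist d) Z W
        + ((ε / 2 : ℝ≥0) + (ε / 2 : ℝ≥0)) := by ring
    _ = _ := by rw [← ENNReal.coe_add, add_halves]

theorem isDistance_revHausdorffZero (hd : IsDistance d) : IsDistance (revHausdorffZero d) :=
  fun _ _ _ => (revHausdorff_le_add_hausdorff hd).trans
    (add_le_add_right hausdorff_le_revHausdorff _)

theorem upperHemi_revHausdorffZero_le (hd : IsDistance d) (Y Z : ZeroDirected d) :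
    upperHemi (revHausdorffZero d) Y Z ≤ hausdorffZero d Y Z :=
  iSup_le fun _ => tsub_le_iff_right.2 (revHausdorff_le_hausdorff_add hd)

theorem lowerHemi_revHausdorffZero_le (hd : IsDistance d) (Y Z : ZeroDirected d) :
    lowerHemi (revHausdorffZero d) Y Z ≤ hausdorffZero d Y Z :=
  iSup_le fun _ => tsub_le_iff_left.2 (revHausdorff_le_add_hausdorff hd)

/-! ### Directed sets of zero aperture and the sets of balls below a point. -/

theorem mem_zeroDirected_iff :
    Y ∈ ZeroDirected d ↔ ∀ F : Set (X × ℝ≥0), F.Finite → F ⊆ Y → ∀ ε : ℝ≥0, 0 < ε →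
      ∃ q ∈ Y, q.2 ≤ ε ∧ ∀ p ∈ F, ballDist d p q ≤ ε := by
  constructor
  · rintro ⟨hY, h0⟩ F hF hFY ε hε
    have hε2 : (0 : ℝ≥0∞) < (ε / 2 : ℝ≥0) := by exact_mod_cast half_pos hε
    obtain ⟨s, hs, hsε⟩ : ∃ s ∈ Y, (s.2 : ℝ≥0∞) < (ε / 2 : ℝ≥0) := by
      rw [← h0] at hε2
      simpa only [aperture, iInf_lt_iff, exists_prop] using hε2
    -- Adding the small ball `s` to `F` forces `q` to be small: its radius is at most that of `s`
    -- plus `ballDist d s q`.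
    have h := hY (insert s F) (hF.insert s) (insert_subset hs hFY)
    rw [← h] at hε2
    simp only [iInf_lt_iff] at hε2
    obtain ⟨q, hq, hlt⟩ := hε2
    have hle := iSup₂_le_iff.1 hlt.le
    refine ⟨q, hq, ?_, fun p hp => (hle p (mem_insert_of_mem _ hp)).trans ?_⟩
    · have := (radius_le_ballDist_add (d := d) s q).trans
        (add_le_add (hle s (mem_insert _ _)) hsε.le)
      rwa [← ENNReal.coe_add, add_halves, ENNReal.coe_le_coe] at this
    · exact_mod_cast half_le_self hε.le
  · intro h
    have key : ∀ a : ℝ≥0∞, (∀ ε : ℝ≥0, 0 < ε → a ≤ ε) → a = 0 := fun a ha =>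
      nonpos_iff_eq_zero.1 <| ENNReal.le_of_forall_pos_le_add fun ε hε _ => by
        simpa using ha ε hε
    refine ⟨fun F hF hFY => key _ fun ε hε => ?_, key _ fun ε hε => ?_⟩
    · obtain ⟨q, hq, -, hle⟩ := h F hF hFY ε hε
      exact (iInf₂_le q hq).trans (iSup₂_le hle)
    · obtain ⟨q, hq, hle, -⟩ := h ∅ finite_empty (empty_subset _) ε hε
      exact (iInf₂_le q hq).trans (by exact_mod_cast hle)

theorem lowerBalls_mem_zeroDirected (hc : IsNetContinuous.{u, v} d (smythTopology d)) (x : X) :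
    lowerBalls d x ∈ ZeroDirected d := by
  refine mem_zeroDirected_iff.2 fun F hF hFx ε hε => ?_
  have hfin : ∀ c ∈ Prod.fst '' F, d c x ≠ ∞ := by
    rintro _ ⟨p, hp, rfl⟩
    exact ((mem_lowerBalls.1 (hFx hp)).trans_lt ENNReal.coe_lt_top).ne
  obtain ⟨y, hyx, hy⟩ := exists_approx hc x (hF.image Prod.fst) hfin (half_pos hε)
  refine ⟨(y, ε / 2), mem_lowerBalls.2 hyx, half_le_self hε.le, fun p hp => ?_⟩
  rw [ballDist_le_iff]
  calc d p.1 y + (ε / 2 : ℝ≥0) ≤ d p.1 x + (ε / 2 : ℝ≥0) + (ε / 2 : ℝ≥0) :=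
        add_le_add_left (hy _ (mem_image_of_mem _ hp)) _
    _ ≤ p.2 + (ε / 2 : ℝ≥0) + (ε / 2 : ℝ≥0) := by
        gcongr
        exact mem_lowerBalls.1 (hFx hp)
    _ = ε + p.2 := by rw [add_assoc, ← ENNReal.coe_add, add_halves, add_comm]

theorem ballDist_le_of_mem_lowerBalls (hd : IsDistance d) {x : X} (hp : p ∈ lowerBalls d x) :
    ballDist d p q ≤ d x q.1 + q.2 := by
  rw [ballDist_le_iff]
  calc d p.1 q.1 + q.2 ≤ d p.1 x + d x q.1 + q.2 := add_le_add_left (hd _ _ _) _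
    _ ≤ p.2 + d x q.1 + q.2 := by
      gcongr
      exact mem_lowerBalls.1 hp
    _ = _ := by ring

theorem revHausdorff_lowerBalls_le (hd : IsDistance d)
    (hc : IsNetContinuous.{u, v} d (smythTopology d)) (x y : X) :
    revHausdorff (ballDist d) (lowerBalls d x) (lowerBalls d y) ≤ d x y := by
  refine ENNReal.le_of_forall_pos_le_add fun ε hε hlt => ?_
  obtain ⟨z, hzy, hz⟩ := exists_approx hc y (finite_singleton x)
    (by simpa using hlt.ne) (half_pos hε)
  refine revHausdorff_le (q := (z, ε / 2)) (mem_lowerBalls.2 hzy) fun p hp => ?_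
  calc _ ≤ d x z + (ε / 2 : ℝ≥0) := ballDist_le_of_mem_lowerBalls hd hp
    _ ≤ d x y + (ε / 2 : ℝ≥0) + (ε / 2 : ℝ≥0) := add_le_add_left (hz x rfl) _
    _ = _ := by rw [add_assoc, ← ENNReal.coe_add, add_halves]

/-- Some `s ∈ Y` is almost above `q`, so `d q.1 s.1 + s.2` is almost at most `q.2`; this sum bounds
the distance to `s` from every ball below `q.1`. -/
theorem revHausdorff_lowerBalls_le_of_mem (hd : IsDistance d) (hY : Y ∈ ZeroDirected d)
    (hq : q ∈ Y) : revHausdorff (ballDist d) (lowerBalls d q.1) Y ≤ q.2 := by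
  refine ENNReal.le_of_forall_pos_le_add fun ε hε _ => ?_
  obtain ⟨s, hs, -, h⟩ := mem_zeroDirected_iff.1 hY {q} (finite_singleton q)
    (singleton_subset_iff.2 hq) ε hε
  refine revHausdorff_le hs fun p hp => (ballDist_le_of_mem_lowerBalls hd hp).trans ?_
  rw [add_comm (q.2 : ℝ≥0∞)]
  exact ballDist_le_iff.1 (h q rfl)

theorem enlarge_mem_lowerBalls {ε : ℝ≥0} (h : ballDist d p q ≤ ε) :
    enlarge p ε ∈ lowerBalls d q.1 := by
  rw [mem_lowerBalls]
  rw [ballDist_le_iff] at h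
  simpa [enlarge, add_comm] using le_self_add.trans h

theorem ballInf_le_ballInf_enlarge_add (p : X × ℝ≥0) (ε : ℝ≥0) :
    ballInf d p Z ≤ ballInf d (enlarge p ε) Z + ε := by
  unfold ballInf
  simp only [ENNReal.iInf_add]
  exact iInf₂_mono fun q _ => ballDist_le_enlarge_add p q ε

theorem ballInf_eq_zero_of_mem (hY : Y ∈ ZeroDirected d) (hp : p ∈ Y) : ballInf d p Y = 0 := by
  refine nonpos_iff_eq_zero.1 <| ENNReal.le_of_forall_pos_le_add fun ε hε _ => ?_
  obtain ⟨q, hq, -, h⟩ := mem_zeroDirected_iff.1 hY {p} (finite_singleton p)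
    (singleton_subset_iff.2 hp) ε hε
  simpa using (ballInf_le hq).trans (h p rfl)

theorem ballInf_lowerBalls_le (hc : IsNetContinuous.{u, v} d (smythTopology d)) {ε : ℝ≥0}
    (h : ballDist d p q ≤ ε) : ballInf d p (lowerBalls d q.1) ≤ ε := by
  simpa [ballInf_eq_zero_of_mem (lowerBalls_mem_zeroDirected hc q.1) (enlarge_mem_lowerBalls h)]
    using ballInf_le_ballInf_enlarge_add (d := d) (Z := lowerBalls d q.1) p ε

theorem hausdorffZero_le_lowerHemi (hd : IsDistance d)
    (hc : IsNetContinuous.{u, v} d (smythTopology d)) (Y Z : ZeroDirected d) :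
    hausdorffZero d Y Z ≤ lowerHemi (revHausdorffZero d) Y Z := by
  refine hausdorff_le_iff.2 fun p hp => ENNReal.le_of_forall_pos_le_add fun ε hε _ => ?_
  obtain ⟨q, hq, hqε, h⟩ := mem_zeroDirected_iff.1 Y.2 {p} (finite_singleton p)
    (singleton_subset_iff.2 hp) (ε / 2) (half_pos hε)
  -- The test point for the lower hemimetric: close to `Y`, yet containing `p` up to an enlargement.
  set W : ZeroDirected d := ⟨lowerBalls d q.1, lowerBalls_mem_zeroDirected hc q.1⟩
  have hWZ : ballInf d (enlarge p (ε / 2)) Z ≤ revHausdorffZero d W Z :=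
    (ballInf_le_hausdorff (enlarge_mem_lowerBalls (h p rfl))).trans hausdorff_le_revHausdorff
  have hWY : revHausdorffZero d W Y ≤ (ε / 2 : ℝ≥0) :=
    (revHausdorff_lowerBalls_le_of_mem hd Y.2 hq).trans (by exact_mod_cast hqε)
  have hlow : revHausdorffZero d W Z ≤
      lowerHemi (revHausdorffZero d) Y Z + revHausdorffZero d W Y :=
    tsub_le_iff_right.1 (le_iSup (fun W => revHausdorffZero d W Z - revHausdorffZero d W Y) W)
  calc ballInf d p Z ≤ ballInf d (enlarge p (ε / 2)) Z + (ε / 2 : ℝ≥0) :=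
        ballInf_le_ballInf_enlarge_add p _
    _ ≤ lowerHemi (revHausdorffZero d) Y Z + (ε / 2 : ℝ≥0) + (ε / 2 : ℝ≥0) :=
        add_le_add_left (hWZ.trans (hlow.trans (add_le_add_right hWY _))) _
    _ = _ := by rw [add_assoc, ← ENNReal.coe_add, add_halves]

/-! ### Completeness. -/

section Limits

variable {L : Type w} {r : L → L → Prop}

/-- Lower Kuratowski-type convergence of directed sets of balls implies Smyth convergence. -/
theorem netConverges_zeroDirected (hd : IsDistance d) {N : L → ZeroDirected d}
    {A : ZeroDirected d}
    (hA : ∀ p ∈ A.1, ∀ ε : ℝ≥0, 0 < ε → ∀ᶠ γ in tails r, ballInf d p (N γ) ≤ ε)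
    (hN : ∀ ε : ℝ≥0, 0 < ε → ∀ᶠ γ in tails r, hausdorffZero d (N γ) A ≤ ε) :
    NetConverges (smythTopology (revHausdorffZero d)) r N A := by
  refine netConverges_smyth_of_forall (fun C ε hε hCA => ?_) fun C ε hε => ?_
  -- One `p ∈ A` serves all of `C`, so pointwise approximation of `A` suffices.
  · obtain ⟨p, hp, h⟩ :=
      exists_of_revHausdorff_le (le_refl (revHausdorffZero d C A)) hCA (half_pos hε)
    filter_upwards [hA p hp (ε / 2) (half_pos hε)] with γ hγ
    calc _ ≤ _ + ballInf d p (N γ) := revHausdorff_le_add_ballInf hd h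
      _ ≤ revHausdorffZero d C A + (ε / 2 : ℝ≥0) + (ε / 2 : ℝ≥0) := add_le_add_right hγ _
      _ = _ := by rw [add_assoc, ← ENNReal.coe_add, add_halves]
  · filter_upwards [hN ε hε] with γ hγ
    exact (revHausdorff_le_add_hausdorff hd).trans (add_le_add_right hγ _)

/-- The balls that are asymptotically below the members of a net of sets of balls. -/
def limitBalls (d : X → X → ℝ≥0∞) (r : L → L → Prop) (N : L → ZeroDirected d) :
    Set (X × ℝ≥0) :=
  {p | ∀ ε : ℝ≥0, 0 < ε → ∀ᶠ γ in tails r, ballInf d p (N γ) ≤ ε}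

/-- The enlargement absorbs the whole Cauchy error, making the distance to every later member
exactly `0`; hence one tail works for all `η`. -/
theorem IsCauchyNet.eventually_enlarge_mem_limitBalls (hr : IsNetOrder r)
    {N : L → ZeroDirected d} (hN : IsCauchyNet (revHausdorffZero d) r N) {ε : ℝ≥0}
    (hε : 0 < ε) : ∀ᶠ γ in tails r, ∀ q ∈ (N γ).1, enlarge q ε ∈ limitBalls d r N := by
  filter_upwards [hN.eventually (half_pos hε)] with γ hγ q hq η hη
  refine (eventually_tails hr).2 ⟨γ, fun δ hδ => ?_⟩
  obtain ⟨s, hs, hqs⟩ := exists_ballDist_le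
    ((ballInf_le_hausdorff hq).trans (hausdorff_le_revHausdorff.trans (hγ δ hδ)))
    ENNReal.coe_ne_top (half_pos hε)
  rw [← ENNReal.coe_add, add_halves] at hqs
  exact (ballInf_le hs).trans (by simp [ballDist_enlarge_eq_zero hqs])

theorem IsCauchyNet.limitBalls_mem_zeroDirected (hd : IsDistance d) (hr : IsNetOrder r)
    {N : L → ZeroDirected d} (hN : IsCauchyNet (revHausdorffZero d) r N) :
    limitBalls d r N ∈ ZeroDirected d := by
  have := tails_neBot hr
  refine mem_zeroDirected_iff.2 fun F hF hFN ε hε => ?_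
  -- Two `η` move `F` into `N γ`, one pays for directedness there, and one for enlarging back into
  -- the limit.
  obtain ⟨η, hη, hηε⟩ : ∃ η : ℝ≥0, 0 < η ∧ η + η + (η + η) = ε :=
    ⟨ε / 2 / 2, half_pos (half_pos hε), by rw [add_halves, add_halves]⟩
  obtain ⟨γ, h₁, h₂⟩ := ((hN.eventually_enlarge_mem_limitBalls hr hη).and
    ((eventually_all_finite hF).2 fun p hp => hFN hp η hη)).exists
  have h₃ : ∀ p ∈ F, ∃ q ∈ (N γ).1, ballDist d p q ≤ η + η := fun p hp =>
    exists_ballDist_le (h₂ p hp) ENNReal.coe_ne_top hη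
  choose! f hfN hf using h₃
  obtain ⟨q, hq, hqη, h⟩ := mem_zeroDirected_iff.1 (N γ).2 (f '' F) (hF.image f)
    (image_subset_iff.2 hfN) η hη
  refine ⟨enlarge q η, h₁ q hq, ?_, fun p hp => ?_⟩
  · calc q.2 + η ≤ η + η := add_le_add_left hqη _
      _ ≤ ε := by rw [← hηε]; exact le_self_add
  · calc _ ≤ ballDist d p q + η := ballDist_enlarge_le p q η
      _ ≤ ballDist d p (f p) + ballDist d (f p) q + η :=
        add_le_add_left (isDistance_ballDist hd _ _ _) _
      _ ≤ η + η + η + η := by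
        gcongr
        · exact hf p hp
        · exact h _ (mem_image_of_mem f hp)
      _ = ε := by rw [← hηε]; push_cast; ring

theorem IsCauchyNet.netConverges_limitBalls (hd : IsDistance d) (hr : IsNetOrder r)
    {N : L → ZeroDirected d} (hN : IsCauchyNet (revHausdorffZero d) r N) :
    NetConverges (smythTopology (revHausdorffZero d)) r N
      ⟨limitBalls d r N, hN.limitBalls_mem_zeroDirected hd hr⟩ := by
  refine netConverges_zeroDirected hd (fun p hp => hp) fun ε hε => ?_
  filter_upwards [hN.eventually_enlarge_mem_limitBalls hr hε] with γ hγ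
  refine hausdorff_le_iff.2 fun p hp => ?_
  simpa [ballInf_eq_zero_of_mem (hN.limitBalls_mem_zeroDirected hd hr) (hγ p hp)]
    using ballInf_le_ballInf_enlarge_add (d := d) (Z := limitBalls d r N) p ε

end Limits

/-! ### The basis of sets of balls below points. -/

/-- Pairs of an element of `Y` and a positive tolerance. -/
abbrev ToleranceIndex (Y : Set (X × ℝ≥0)) : Type u := Y × {ε : ℝ≥0 // 0 < ε}

/-- The relation on tolerance indices making the elements of `Y` a Cauchy net. -/
def toleranceRel (d : X → X → ℝ≥0∞) (Y : Set (X × ℝ≥0)) (a b : ToleranceIndex Y) : Prop :=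
  ballDist d a.1 b.1 + b.2.1 ≤ a.2.1

theorem isNetOrder_toleranceRel (hd : IsDistance d) (hY : Y ∈ ZeroDirected d) :
    IsNetOrder fun a b : ULift.{w} (ToleranceIndex Y) => toleranceRel d Y a.down b.down := by
  refine ⟨?_, fun a b c hab hbc => ?_, fun a b => ?_⟩
  · obtain ⟨q, hq, -⟩ := mem_zeroDirected_iff.1 hY ∅ finite_empty (empty_subset _) 1 one_pos
    exact ⟨⟨⟨q, hq⟩, 1, one_pos⟩⟩
  · refine le_trans ?_ hab
    refine le_trans ?_ (add_le_add_right hbc _)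
    rw [← add_assoc]
    exact add_le_add_left (isDistance_ballDist hd _ _ _) _
  · obtain ⟨⟨p, ε, hε⟩⟩ := a
    obtain ⟨⟨q, η, hη⟩⟩ := b
    -- Half of the smaller tolerance is spent on distances, half kept as the new tolerance.
    have hm : 0 < min ε η / 2 := half_pos (lt_min hε hη)
    obtain ⟨s, hs, -, h⟩ := mem_zeroDirected_iff.1 hY {p.1, q.1} (by simp)
      (by rintro x (rfl | rfl); exacts [p.2, q.2]) _ hm
    have key : ∀ t ∈ ({p.1, q.1} : Set (X × ℝ≥0)),
        ballDist d t s + (min ε η / 2 : ℝ≥0) ≤ (min ε η : ℝ≥0) := fun t ht =>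
      (add_le_add_left (h t ht) _).trans_eq (by rw [← ENNReal.coe_add, add_halves])
    exact ⟨⟨⟨s, hs⟩, _, hm⟩,
      (key p.1 (by simp)).trans (by exact_mod_cast min_le_left _ _),
      (key q.1 (by simp)).trans (by exact_mod_cast min_le_right _ _)⟩

theorem isNetBasis_range_lowerBalls (hd : IsDistance d)
    (hc : IsNetContinuous.{u, v} d (smythTopology d)) (h : ∀ x : X, lowerBalls d x ∈ ZeroDirected d) :
    IsNetBasis.{u, max u w} (revHausdorffZero d) (smythTopology (revHausdorffZero d))
      (range fun x : X => (⟨lowerBalls d x, h x⟩ : ZeroDirected d)) := by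
  intro Y
  have hr := isNetOrder_toleranceRel.{u, w} hd Y.2
  have hdist : ∀ p ∈ Y.1, ∀ ε : ℝ≥0, 0 < ε →
      ∀ᶠ γ in tails fun a b : ULift.{w} (ToleranceIndex Y.1) => toleranceRel d Y.1 a.down b.down,
        ballDist d p γ.down.1 ≤ ε ∧ γ.down.2.1 ≤ ε := fun p hp ε hε =>
    (eventually_tails hr).2 ⟨⟨⟨p, hp⟩, ε, hε⟩, fun δ hδ =>
      ⟨le_self_add.trans hδ, ENNReal.coe_le_coe.1 (le_add_self.trans hδ)⟩⟩
  have hsmall : ∀ ε : ℝ≥0, 0 < ε →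
      ∀ᶠ γ in tails fun a b : ULift.{w} (ToleranceIndex Y.1) => toleranceRel d Y.1 a.down b.down,
        γ.down.1.1.2 ≤ ε ∧ γ.down.2.1 ≤ ε := by
    intro ε hε
    -- Past a small ball `q` all radii are small, since a radius grows by at most the distance from
    -- `q`.
    obtain ⟨q, hq, hqε, -⟩ := mem_zeroDirected_iff.1 Y.2 ∅ finite_empty (empty_subset _) (ε / 2)
      (half_pos hε)
    filter_upwards [hdist q hq (ε / 2) (half_pos hε)] with γ hγ
    refine ⟨?_, hγ.2.trans (half_le_self hε.le)⟩
    have := (radius_le_ballDist_add (d := d) q γ.down.1).trans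
      (add_le_add hγ.1 (ENNReal.coe_le_coe.2 hqε))
    rwa [← ENNReal.coe_add, add_halves, ENNReal.coe_le_coe] at this
  refine ⟨ULift.{w} (ToleranceIndex Y.1), _, fun γ => ⟨lowerBalls d γ.down.1.1.1, h _⟩, hr,
    isCauchyNet_iff.2 fun ε hε => ?_, fun γ => ⟨_, rfl⟩,
    netConverges_zeroDirected hd (fun p hp ε hε => ?_) fun ε hε => ?_⟩
  · filter_upwards [hsmall (ε / 2) (half_pos hε)] with γ hγ δ hδ
    calc _ ≤ d γ.down.1.1.1 δ.down.1.1.1 := revHausdorff_lowerBalls_le hd hc _ _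
      _ ≤ ballDist d γ.down.1.1 δ.down.1.1 + γ.down.1.1.2 :=
        le_self_add.trans (dist_add_le_ballDist_add _ _)
      _ ≤ (ε / 2 : ℝ≥0) + (ε / 2 : ℝ≥0) := add_le_add
        (le_self_add.trans (hδ.trans (ENNReal.coe_le_coe.2 hγ.2))) (ENNReal.coe_le_coe.2 hγ.1)
      _ = ε := by rw [← ENNReal.coe_add, add_halves]
  · filter_upwards [hdist p hp ε hε] with γ hγ
    exact ballInf_lowerBalls_le hc hγ.1
  · filter_upwards [hsmall ε hε] with γ hγ
    exact hausdorff_le_revHausdorff.trans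
      ((revHausdorff_lowerBalls_le_of_mem hd Y.2 γ.down.1.2).trans (ENNReal.coe_le_coe.2 hγ.1))

end Balls

end DistanceDomain

theorem mainTheorem11 {X : Type u} (d : X → X → ℝ≥0∞) (hd : IsDistance d)
    (hc : IsNetContinuous.{u, v} d (smythTopology d)) :
    lowerHemi (revHausdorffZero d) = hausdorffZero d ∧
    IsNetDomain.{u, max u w} (revHausdorffZero d)
      (smythTopology (revHausdorffZero d)) ∧
    ∃ h : ∀ x : X, lowerBalls d x ∈ ZeroDirected d,
      IsNetBasis.{u, max u w} (revHausdorffZero d)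
        (smythTopology (revHausdorffZero d))
        (range fun x : X => (⟨lowerBalls d x, h x⟩ : ZeroDirected d)) ∧
      ∀ x y : X, revHausdorffZero d ⟨lowerBalls d x, h x⟩ ⟨lowerBalls d y, h y⟩ ≤ d x y := by
  have hH : lowerHemi (revHausdorffZero d) = hausdorffZero d :=
    funext₂ fun Y Z => (lowerHemi_revHausdorffZero_le hd Y Z).antisymm
      (hausdorffZero_le_lowerHemi hd hc Y Z)
  have hmem := lowerBalls_mem_zeroDirected hc
  have hB := isNetBasis_range_lowerBalls.{u, v, w} hd hc hmem
  refine ⟨hH, ⟨isDistance_revHausdorffZero hd, ⟨fun Y => ?_, fun Y Z => ?_⟩,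
    fun L r N hr hN => ⟨_, hN.netConverges_limitBalls hd hr⟩⟩, hmem, hB,
    revHausdorff_lowerBalls_le hd hc⟩
  · obtain ⟨L, r, N, hr, hN, -, hY⟩ := hB Y
    exact ⟨L, r, N, hr, hN, hY⟩
  · rw [hH]
    exact upperHemi_revHausdorffZero_le hd Y Z
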